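/- Let $\Gamma$ be a countable discrete $C^*$-simple group, i.e. the reduced group $C^*$-algebra $C^*_r(\Gamma)\subseteq\mathbb B(\ell^2(\Gamma))$ generated by the left regular representation $\lambda$ is simple. Let $\mathcal A$ be a non-zero unital $C^*$-algebra on which $\Gamma$ acts by $*$-automorphisms. For a probability measure $\mu$ on $\Gamma$, a state $\tau$ on a unital $C^*$-algebra with a $\Gamma$-action is called $\mu$-stationary if $\sum_{s\in\Gamma}\mu(s)\,\tau(s^{-1}a)=\tau(a)$ for all $a$; the measure $\mu$ is called $C^*$-simple if the canonical trace $\tau_0$ (with $\tau_0(\lambda_e)=1$ and $\tau_0(\lambda_s)=0$ for $s\ne e$) is the unique $\mu$-stationary state on $C^*_r(\Gamma)$ with respect to the action of $\Gamma$ by the inner automorphisms $x\mapsto\lambda_s x\lambda_s^*$. Suppose that for some $C^*$-simple probability measure $\mu$ on $\Gamma$ all $\mu$-stationary states on $\mathcal A$ are faithful. Let $\pi:\mathcal A\to\mathbb B(H)$ be a faithful unital $*$-representation on a Hilbert space $H$. Realize the reduced crossed product $\Gamma\ltimes_r\mathcal A$ as the $C^*$-subalgebra of $\mathbb B(\ell^2(\Gamma,H))$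 generated by the operators $(\tilde\lambda_s\xi)(t)=\xi(s^{-1}t)$, $s\in\Gamma$, and $(\sigma(a)\xi)(t)=\pi(t^{-1}a)(\xi(t))$, $a\in\mathcal A$, and identify $C^*_r(\Gamma)$ with the $C^*$-subalgebra of $\Gamma\ltimes_r\mathcal A$ generated by $\{\tilde\lambda_s:s\in\Gamma\}$. Then every intermediate $C^*$-algebra $$C^*_r(\Gamma)\subseteq\mathcal B\subseteq\Gamma\ltimes_r\mathcal A$$ is simple, i.e. $\mathcal B\neq 0$ and $\mathcal B$ has no closed two-sided ideals other than $0$ and $\mathcal B$. -/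

import Mathlib

open scoped ENNReal ComplexOrder

noncomputable section

namespace CrossedProd

/-- The Hilbert space `ℓ²(Γ, H)` of square summable `H`-valued functions on `Γ`. -/
abbrev L2 (Γ : Type*) (H : Type*) [NormedAddCommGroup H] : Type _ :=
  lp (fun _ : Γ => H) 2

theorem memℓp_translate {Γ : Type*} [Group Γ] {H : Type*} [NormedAddCommGroup H] (s : Γ)
    (ξ : L2 Γ H) : Memℓp (fun t : Γ => ξ (s * t)) 2 := by
  have h : Summable fun t : Γ => ‖ξ t‖ ^ (2 : ℝ≥0∞).toReal :=
    (lp.memℓp ξ).summable (by norm_num)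
  apply memℓp_gen
  exact h.comp_injective (mul_right_injective s)

section Translation

variable (Γ : Type*) [Group Γ] (H : Type*) [NormedAddCommGroup H] [InnerProductSpace ℂ H]

/-- Left translation `(λ̃_s ξ)(t) = ξ(s⁻¹ t)` on `ℓ²(Γ, H)`, as a linear isometric bijection. -/
def translationIsometry (s : Γ) : L2 Γ H ≃ₗᵢ[ℂ] L2 Γ H where
  toFun ξ := ⟨fun t => ξ (s⁻¹ * t), memℓp_translate s⁻¹ ξ⟩
  invFun ξ := ⟨fun t => ξ (s * t), memℓp_translate s ξ⟩
  map_add' _ _ := by ext; rfl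
  map_smul' _ _ := by ext; rfl
  left_inv ξ := by ext t; simp
  right_inv ξ := by ext t; simp
  norm_map' ξ := by
    have h2 : 0 < (2 : ℝ≥0∞).toReal := by norm_num
    rw [lp.norm_eq_tsum_rpow h2, lp.norm_eq_tsum_rpow h2]
    congr 1
    exact (Equiv.mulLeft s⁻¹).tsum_eq (fun t => ‖ξ t‖ ^ (2 : ℝ≥0∞).toReal)

/-- `s ↦ λ̃_s` as a group homomorphism into the isometric bijections of `ℓ²(Γ, H)`. -/
def translationHom : Γ →* (L2 Γ H ≃ₗᵢ[ℂ] L2 Γ H) where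
  toFun := translationIsometry Γ H
  map_one' := by ext ξ t; simp [translationIsometry]
  map_mul' s r := by ext ξ t; simp [translationIsometry, mul_assoc]

variable [CompleteSpace H]

/-- The unitary representation `λ̃` of `Γ` on `ℓ²(Γ, H)` by left translations; for `H = ℂ` this is
the left regular representation `λ`. -/
def translation : Γ →* unitary (L2 Γ H →L[ℂ] L2 Γ H) :=
  (Unitary.linearIsometryEquiv (𝕜 := ℂ) (H := L2 Γ H)).symm.toMonoidHom.comp (translationHom Γ H)

/-- The C⋆-subalgebra of `B(ℓ²(Γ, H))` generated by the translation unitaries `λ̃_s`, `s ∈ Γ`. For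
`H = ℂ` it is the reduced group C⋆-algebra; for any `H ≠ 0` it is the canonical copy of the reduced
group C⋆-algebra on `ℓ²(Γ, H) = ℓ²(Γ) ⊗ H`. -/
def groupCStar : StarSubalgebra ℂ (L2 Γ H →L[ℂ] L2 Γ H) :=
  (StarAlgebra.adjoin ℂ
    (Set.range fun s : Γ => (translation Γ H s : L2 Γ H →L[ℂ] L2 Γ H))).topologicalClosure

end Translation

section CrossedProduct

variable {Γ : Type*} [Group Γ] {A : Type*} [CStarAlgebra A]
  {H : Type*} [NormedAddCommGroup H] [InnerProductSpace ℂ H] [CompleteSpace H]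

/-- The operator `(σ(a) ξ)(t) = π(t⁻¹ a) (ξ(t))` on `ℓ²(Γ, H)`, for an action `α` of `Γ` on `A` by
`⋆`-automorphisms and a unital `⋆`-representation `π` of `A` on `H`. -/
def sigma (α : Γ →* (A ≃⋆ₐ[ℂ] A)) (π : A →⋆ₐ[ℂ] (H →L[ℂ] H)) (a : A) :
    L2 Γ H →L[ℂ] L2 Γ H :=
  lp.mapCLM 2 (fun t : Γ => π (α t⁻¹ a)) (norm_nonneg a) fun t =>
    (NonUnitalStarAlgHom.norm_apply_le π _).trans (StarAlgEquiv.norm_map (α t⁻¹) a).le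

/-- The reduced crossed product `Γ ⋉_r A`, realized on `ℓ²(Γ, H)` through `π`: the C⋆-algebra
generated by all `λ̃_s` and all `σ(a)`. (It is the reduced crossed product when `π` is faithful.) -/
def reducedCrossedProduct (α : Γ →* (A ≃⋆ₐ[ℂ] A)) (π : A →⋆ₐ[ℂ] (H →L[ℂ] H)) :
    StarSubalgebra ℂ (L2 Γ H →L[ℂ] L2 Γ H) :=
  (StarAlgebra.adjoin ℂ
    ((Set.range fun s : Γ => (translation Γ H s : L2 Γ H →L[ℂ] L2 Γ H)) ∪
      Set.range (sigma α π))).topologicalClosure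

end CrossedProduct

section States

variable {Γ : Type*} [Group Γ] {A : Type*} [Ring A] [StarRing A] [Algebra ℂ A]

/-- States: positive linear functionals of value one at the unit. -/
def IsState (φ : A →ₗ[ℂ] ℂ) : Prop :=
  (∀ a : A, 0 ≤ φ (star a * a)) ∧ φ 1 = 1

/-- Faithfulness of a positive functional. -/
def IsFaithful (φ : A →ₗ[ℂ] ℂ) : Prop :=
  ∀ a : A, φ (star a * a) = 0 → a = 0

/-- `μ`-stationarity, `∑ₛ μ(s) φ(s⁻¹ a) = φ(a)`, with respect to an action `α` of `Γ`. -/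
def IsStationary (μ : PMF Γ) (α : Γ →* (A ≃⋆ₐ[ℂ] A)) (φ : A →ₗ[ℂ] ℂ) : Prop :=
  ∀ a : A, HasSum (fun s : Γ => ((μ s).toReal : ℂ) * φ (α s⁻¹ a)) (φ a)

end States

/-- Simplicity of a C⋆-algebra: it is non-zero and has no closed two-sided ideals other than `0` and
the whole algebra. -/
def IsSimpleCStar (B : Type*) [Ring B] [TopologicalSpace B] : Prop :=
  Nontrivial B ∧ ∀ I : TwoSidedIdeal B, IsClosed (I : Set B) → I = ⊥ ∨ I = ⊤

section ReducedGroupAlgebra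

variable (Γ : Type*) [Group Γ]

/-- The reduced group C⋆-algebra, generated by the left regular representation on `ℓ²(Γ)`. -/
abbrev reducedCStar : StarSubalgebra ℂ (L2 Γ ℂ →L[ℂ] L2 Γ ℂ) :=
  groupCStar Γ ℂ

/-- `Γ` is C⋆-simple when its reduced C⋆-algebra is simple. -/
def IsCStarSimpleGroup : Prop :=
  IsSimpleCStar (reducedCStar Γ)

/-- The unitaries `λ_s` as elements of the reduced group C⋆-algebra. -/
def leftRegular : Γ →* unitary (reducedCStar Γ) where
  toFun s := ⟨⟨translation Γ ℂ s, StarSubalgebra.le_topologicalClosure _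
      (StarAlgebra.subset_adjoin ℂ _ ⟨s, rfl⟩)⟩, by
    rw [Unitary.mem_iff]
    exact ⟨Subtype.ext (Unitary.coe_star_mul_self (translation Γ ℂ s)),
      Subtype.ext (Unitary.coe_mul_star_self (translation Γ ℂ s))⟩⟩
  map_one' := by ext1; ext1; simp
  map_mul' s t := by ext1; ext1; simp

/-- The action of `Γ` on its reduced C⋆-algebra by the inner automorphisms `x ↦ λ_s x λ_s*`. -/
def innerAction : Γ →* (reducedCStar Γ ≃⋆ₐ[ℂ] reducedCStar Γ) :=
  (Unitary.conjStarAlgAut ℂ (reducedCStar Γ)).comp (leftRegular Γ)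

open Classical in
/-- The canonical trace `τ₀(x) = ⟨δ_e, x δ_e⟩` on the reduced group C⋆-algebra; it takes the value
`1` at `λ_e` and `0` at every other `λ_s`. -/
def canonicalTrace : reducedCStar Γ →ₗ[ℂ] ℂ where
  toFun x := inner ℂ (lp.single 2 (1 : Γ) (1 : ℂ) : L2 Γ ℂ)
    ((x : L2 Γ ℂ →L[ℂ] L2 Γ ℂ) (lp.single 2 (1 : Γ) (1 : ℂ)))
  map_add' x y := by simp
  map_smul' c x := by simp

variable {Γ} in
/-- `μ` is a C⋆-simple measure when the canonical trace is the unique `μ`-stationary state on the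
reduced group C⋆-algebra, for the inner action of `Γ`. -/
def IsCStarSimpleMeasure (μ : PMF Γ) : Prop :=
  ∀ φ : reducedCStar Γ →ₗ[ℂ] ℂ,
    (IsState φ ∧ IsStationary μ (innerAction Γ) φ) ↔ φ = canonicalTrace Γ

end ReducedGroupAlgebra

end CrossedProd

end

/-!
Let `P x = ∑ₛ μ(s) λ̃ₛ⋆ x λ̃ₛ` be the averaging operator of a C⋆-simple measure `μ`, acting on all
bounded operators on `ℓ²(Γ, H)`. A functional is `μ`-stationary when it is `P`-invariant, and
invariant functionals arise as ultrafilter limits along the Cesàro means of the powers of `P`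
(`exists_invariant_limit`).

Given a proper closed ideal `I` of `B`, Hahn–Banach in the quotient by `I` gives a state on
`B(ℓ²(Γ, H))` that vanishes on `I` (`exists_functional_annihilating`). As `I` is invariant under
conjugation by the `λ̃ₛ ∈ B`, an invariant limit `ψ` still vanishes on `I`. The claim is that `ψ` is
faithful on the reduced crossed product (`eq_zero_of_apply_star_mul_self_eq_zero`); then `I = 0`,
because `ψ(b⋆ b) = 0` for `b ∈ I`.

The restriction of `ψ` to `A` is a stationary state, hence faithful by hypothesis, and it remains to
see that `ψ` factors through the canonical conditional expectation onto `A`, that is, that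
`ψ(σ(a) λ̃ₛ) = 0` for `s ≠ 1`. Uniqueness of the stationary state on the reduced group C⋆-algebra
makes the Cesàro means of `λₛ` arbitrarily small in norm (`exists_norm_cesaro_translation_lt`). The
means of `σ(a) λ̃ₛ` are combinations of operators `σ(aᵢ) λ̃ₜ`, with `‖aᵢ‖ ≤ ‖a‖`, in which the `λ̃ₜ`
have the same nonnegative weights as in the means of `λₛ`; comparing pointwise norms of vectors
shows that their norms are at most `‖a‖` times those of the means of `λₛ` (`IsDominatedBy`). Since
`ψ` takes the same value at an operator and at its means, the value at `σ(a) λ̃ₛ` is zero.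
-/

noncomputable section

namespace CrossedProd

open Filter Topology
open scoped CStarAlgebra

/-! ### Positivity in C⋆-algebras -/

section Positivity

variable {E : Type*} [CStarAlgebra E]

theorem norm_algebraMap_norm_sub_star_mul_self_le (a : E) :
    ‖algebraMap ℝ E ‖star a * a‖ - star a * a‖ ≤ ‖star a * a‖ := by
  let _ := CStarAlgebra.spectralOrder E
  have _ := CStarAlgebra.spectralOrderedRing E
  have h := (SpectrumRestricts.nnreal_iff_nnnorm (IsSelfAdjoint.star_mul_self a)
    (le_refl ‖star a * a‖₊)).1
      (SpectrumRestricts.nnreal_of_nonneg (star_mul_self_nonneg a))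
  exact_mod_cast h

/-- An injective `⋆`-homomorphism reflects positivity, since it preserves real spectra of
self-adjoint elements. -/
theorem exists_eq_star_mul_self_of_map {F : Type*} [CStarAlgebra F] (f : E →⋆ₐ[ℂ] F)
    (hf : Function.Injective f) {a : E} {y : F} (h : f a = star y * y) :
    ∃ c : E, a = star c * c := by
  let _ := CStarAlgebra.spectralOrder E
  have _ := CStarAlgebra.spectralOrderedRing E
  let _ := CStarAlgebra.spectralOrder F
  have _ := CStarAlgebra.spectralOrderedRing F
  have ha : IsSelfAdjoint a := by
    apply hf
    rw [map_star, h]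
    simp
  rw [← CStarAlgebra.nonneg_iff_eq_star_mul_self,
    StarOrderedRing.nonneg_iff_spectrum_nonneg (R := ℝ) a, ← ha.map_spectrum_real f hf,
    ← StarOrderedRing.nonneg_iff_spectrum_nonneg (R := ℝ) (f a) (ha.map f), h]
  exact star_mul_self_nonneg y

/-- A contractive functional with `f 1 = 1` is real on self-adjoint elements: otherwise
`|f (a + i t)|` would exceed `‖a + i t‖ ≤ (‖a‖² + t²)^(1/2)` for a large real `t`. -/
theorem im_apply_eq_zero_of_isSelfAdjoint {f : E →L[ℂ] ℂ} (hf : ‖f‖ ≤ 1) (h1 : f 1 = 1) {a : E}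
    (ha : IsSelfAdjoint a) : (f a).im = 0 := by
  have key : ∀ t : ℝ, (f a).im ^ 2 + 2 * t * (f a).im ≤ ‖a‖ ^ 2 := by
    intro t
    set z : E := a + (t * Complex.I : ℂ) • 1 with hz
    have hfz : f z = f a + t * Complex.I := by simp [hz, h1]
    have h2 : ‖f z‖ ≤ ‖z‖ := by
      simpa using f.le_of_opNorm_le hf z
    have hzz : star z * z = a * a + ((t ^ 2 : ℝ) : ℂ) • 1 := by
      have hs : star z = a - (t * Complex.I : ℂ) • 1 := by
        simp [hz, ha.star_eq, sub_eq_add_neg]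
      rw [hs, hz]
      simp only [sub_mul, mul_add, mul_smul_comm, smul_mul_assoc, mul_one, one_mul, smul_sub,
        smul_smul]
      have : (t * Complex.I * (t * Complex.I) : ℂ) = -((t ^ 2 : ℝ) : ℂ) := by
        push_cast
        linear_combination (t : ℂ) ^ 2 * Complex.I_sq
      rw [this, neg_smul]
      abel
    have h3 : ‖z‖ ^ 2 ≤ ‖a‖ ^ 2 + t ^ 2 := by
      rw [sq, ← CStarRing.norm_star_mul_self, hzz]
      refine (norm_add_le _ _).trans (add_le_add ?_ ?_)
      · rw [sq]
        exact norm_mul_le _ _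
      · refine (norm_smul_le _ _).trans ?_
        rw [Complex.norm_real, Real.norm_of_nonneg (sq_nonneg t)]
        refine mul_le_of_le_one_right (sq_nonneg t) ?_
        nontriviality E
        exact CStarRing.norm_one.le
    have h4 : ((f a).im + t) ^ 2 ≤ ‖f z‖ ^ 2 := by
      rw [hfz, ← Complex.normSq_eq_norm_sq, Complex.normSq_apply]
      simp
      nlinarith [sq_nonneg (f a).re]
    have h5 : ‖f z‖ ^ 2 ≤ ‖z‖ ^ 2 := by gcongr
    nlinarith
  by_contra hne
  -- at this `t` the left side of `key` is `(f a).im ^ 2 + ‖a‖ ^ 2 + 1`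
  have h6 := key ((‖a‖ ^ 2 + 1) / (2 * (f a).im))
  have h7 : 2 * ((‖a‖ ^ 2 + 1) / (2 * (f a).im)) * (f a).im = ‖a‖ ^ 2 + 1 := by
    field_simp
  rw [h7] at h6
  nlinarith [sq_nonneg (f a).im]

/-- A contractive functional with `f 1 = 1` is positive: for `h = a⋆ a` one has `‖ ‖h‖ - h ‖ ≤ ‖h‖`,
so the real number `f h` is within `‖h‖` of `‖h‖`. -/
theorem apply_star_mul_self_nonneg {f : E →L[ℂ] ℂ} (hf : ‖f‖ ≤ 1) (h1 : f 1 = 1) (a : E) :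
    0 ≤ f (star a * a) := by
  have him := im_apply_eq_zero_of_isSelfAdjoint hf h1 (IsSelfAdjoint.star_mul_self a)
  refine Complex.nonneg_iff.2 ⟨?_, him.symm⟩
  have h2 : ‖f (algebraMap ℝ E ‖star a * a‖ - star a * a)‖ ≤ ‖star a * a‖ :=
    (by simpa using f.le_of_opNorm_le hf (algebraMap ℝ E ‖star a * a‖ - star a * a) :
      ‖f (algebraMap ℝ E ‖star a * a‖ - star a * a)‖ ≤ _).trans
        (norm_algebraMap_norm_sub_star_mul_self_le a)
  have h3 : f (algebraMap ℝ E ‖star a * a‖ - star a * a) = ‖star a * a‖ - f (star a * a) := by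
    rw [map_sub, IsScalarTower.algebraMap_apply ℝ ℂ E, Algebra.algebraMap_eq_smul_one, map_smul, h1]
    simp
  rw [h3] at h2
  have h4 := (Complex.re_le_norm _).trans h2
  simp only [Complex.sub_re, Complex.ofReal_re] at h4
  linarith

end Positivity

/-! ### Cesàro means and invariant functionals -/

section Cesaro

variable {E : Type*} [NormedAddCommGroup E] [NormedSpace ℂ E]

/-- The Cesàro mean `(n + 1)⁻¹ ∑_{k ≤ n} P ^ k` of an operator `P`. -/
def cesaro (P : E →L[ℂ] E) (n : ℕ) : E →L[ℂ] E :=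
  ((n : ℂ) + 1)⁻¹ • ∑ k ∈ Finset.range (n + 1), P ^ k

theorem cesaro_apply (P : E →L[ℂ] E) (n : ℕ) (x : E) :
    cesaro P n x = ((n : ℂ) + 1)⁻¹ • ∑ k ∈ Finset.range (n + 1), (P ^ k) x := by
  simp [cesaro]

theorem norm_natCast_add_one (n : ℕ) : ‖(n : ℂ) + 1‖ = n + 1 := by
  exact_mod_cast Complex.norm_natCast (n + 1)

theorem norm_pow_apply_le {P : E →L[ℂ] E} (hP : ‖P‖ ≤ 1) (k : ℕ) (x : E) : ‖(P ^ k) x‖ ≤ ‖x‖ := by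
  induction k with
  | zero => simp
  | succ k ih =>
    rw [pow_succ']
    exact (P.le_of_opNorm_le hP _).trans (by rwa [one_mul])

theorem norm_cesaro_apply_le {P : E →L[ℂ] E} (hP : ‖P‖ ≤ 1) (n : ℕ) (x : E) :
    ‖cesaro P n x‖ ≤ ‖x‖ := by
  rw [cesaro_apply, norm_smul, norm_inv, norm_natCast_add_one]
  have h : ‖∑ k ∈ Finset.range (n + 1), (P ^ k) x‖ ≤ (n + 1) * ‖x‖ := by
    refine (norm_sum_le_of_le _ fun k _ => norm_pow_apply_le hP k x).trans ?_
    simp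
  rw [inv_mul_le_iff₀ (by positivity)]
  exact h

theorem norm_cesaro_apply_map_sub_le {P : E →L[ℂ] E} (hP : ‖P‖ ≤ 1) (n : ℕ) (x : E) :
    ‖cesaro P n (P x) - cesaro P n x‖ ≤ ((n : ℝ) + 1)⁻¹ * (2 * ‖x‖) := by
  have h : cesaro P n (P x) - cesaro P n x = ((n : ℂ) + 1)⁻¹ • ((P ^ (n + 1)) x - x) := by
    rw [cesaro_apply, cesaro_apply, ← smul_sub, ← Finset.sum_sub_distrib]
    congr 1
    have := Finset.sum_range_sub (fun k => (P ^ k) x) (n + 1)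
    simpa [pow_succ] using this
  rw [h, norm_smul, norm_inv, norm_natCast_add_one]
  gcongr
  refine (norm_sub_le _ _).trans ?_
  linarith [norm_pow_apply_le hP (n + 1) x]

theorem cesaro_apply_of_fixed {P : E →L[ℂ] E} {x : E} (hx : P x = x) (n : ℕ) :
    cesaro P n x = x := by
  have h : ∀ k, (P ^ k) x = x := by
    intro k
    induction k with
    | zero => simp
    | succ k ih => rw [pow_succ', mul_apply_eq_comp, ih, hx]
  have h0 : (n : ℂ) + 1 ≠ 0 := by exact_mod_cast n.succ_ne_zero
  rw [cesaro_apply, Finset.sum_congr rfl fun k _ => h k, Finset.sum_const, Finset.card_range,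
    ← Nat.cast_smul_eq_nsmul ℂ, smul_smul]
  push_cast
  rw [inv_mul_cancel₀ h0, one_smul]

theorem cesaro_apply_mem {P : E →L[ℂ] E} {V : Submodule ℂ E} (hV : ∀ x ∈ V, P x ∈ V) {x : E}
    (hx : x ∈ V) (n : ℕ) : cesaro P n x ∈ V := by
  rw [cesaro_apply]
  suffices h : ∀ k, (P ^ k) x ∈ V from V.smul_mem _ (V.sum_mem fun k _ => h k)
  intro k
  induction k with
  | zero => simpa using hx
  | succ k ih =>
    rw [pow_succ']
    exact hV _ ih

theorem apply_cesaro_apply_of_invariant {P : E →L[ℂ] E} {f : E →L[ℂ] ℂ} (hf : ∀ x, f (P x) = f x)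
    (n : ℕ) (x : E) : f (cesaro P n x) = f x := by
  have h : ∀ k, f ((P ^ k) x) = f x := by
    intro k
    induction k with
    | zero => simp
    | succ k ih => rw [pow_succ', mul_apply_eq_comp, hf, ih]
  have h0 : (n : ℂ) + 1 ≠ 0 := by exact_mod_cast n.succ_ne_zero
  rw [cesaro_apply, map_smul, map_sum, Finset.sum_congr rfl fun k _ => h k]
  simp [h0]

/-- Markov–Kakutani by hand: a limit along an ultrafilter of contractive functionals composed with
the Cesàro means of a contraction `P` is a `P`-invariant contractive functional. -/
theorem exists_invariant_limit {P : E →L[ℂ] E} (hP : ‖P‖ ≤ 1) (f : ℕ → E →L[ℂ] ℂ)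
    (hf : ∀ n, ‖f n‖ ≤ 1) :
    ∃ ψ : E →L[ℂ] ℂ, ‖ψ‖ ≤ 1 ∧ (∀ x, ψ (P x) = ψ x) ∧
      ∀ (x : E) (C : Set ℂ), IsClosed C → (∀ n, f n (cesaro P n x) ∈ C) → ψ x ∈ C := by
  have hb : ∀ n x, ‖f n (cesaro P n x)‖ ≤ ‖x‖ := fun n x =>
    ((f n).le_of_opNorm_le (hf n) _).trans (by simpa using norm_cesaro_apply_le hP n x)
  have hlim : ∀ x, ∃ y, Tendsto (fun n => f n (cesaro P n x)) (hyperfilter ℕ) (𝓝 y) := by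
    intro x
    obtain ⟨y, -, hy⟩ := (isCompact_closedBall (0 : ℂ) ‖x‖).ultrafilter_le_nhds
      ((hyperfilter ℕ).map fun n => f n (cesaro P n x)) (by
        rw [le_principal_iff, Ultrafilter.coe_map, mem_map]
        exact Filter.univ_mem' fun n => mem_closedBall_zero_iff.2 (hb n x))
    exact ⟨y, hy⟩
  choose ψ hψ using hlim
  have hclosed : ∀ (x : E) (C : Set ℂ), IsClosed C → (∀ n, f n (cesaro P n x) ∈ C) → ψ x ∈ C :=
    fun x C hC h => hC.mem_of_tendsto (hψ x) (Eventually.of_forall h)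
  let ψ' : E →ₗ[ℂ] ℂ :=
    { toFun := ψ
      map_add' := fun x y => tendsto_nhds_unique (hψ (x + y)) (by
        simpa using (hψ x).add (hψ y))
      map_smul' := fun c x => tendsto_nhds_unique (hψ (c • x)) (by
        simpa using (hψ x).const_mul c) }
  refine ⟨ψ'.mkContinuous 1 fun x => ?_, ψ'.mkContinuous_norm_le zero_le_one _, fun x => ?_,
    hclosed⟩
  · have := hclosed x (Metric.closedBall 0 ‖x‖) Metric.isClosed_closedBall
      fun n => by simpa using hb n x
    rw [one_mul]
    exact mem_closedBall_zero_iff.1 this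
  · have h0 : Tendsto (fun n : ℕ => ((n : ℝ) + 1)⁻¹ * (2 * ‖x‖)) (hyperfilter ℕ) (𝓝 0) := by
      have h1 : Tendsto (fun n : ℕ => ((n : ℝ) + 1)⁻¹) atTop (𝓝 0) := by
        simpa using tendsto_one_div_add_atTop_nhds_zero_nat (𝕜 := ℝ)
      have h2 := h1.mul_const (2 * ‖x‖)
      rw [zero_mul] at h2
      exact h2.mono_left Nat.hyperfilter_le_atTop
    have h3 : Tendsto (fun n => f n (cesaro P n (P x)) - f n (cesaro P n x)) (hyperfilter ℕ)
        (𝓝 0) := by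
      refine squeeze_zero_norm (fun n => ?_) h0
      rw [← map_sub]
      refine ((f n).le_of_opNorm_le (hf n) _).trans ?_
      rw [one_mul]
      exact norm_cesaro_apply_map_sub_le hP n x
    exact sub_eq_zero.1 (tendsto_nhds_unique ((hψ (P x)).sub (hψ x)) h3)

end Cesaro

/-! ### Averaging by conjugation -/

section Averaging

variable {Γ : Type*} [Group Γ] {E : Type*} [CStarAlgebra E]

theorem summable_toReal_pmf {Γ : Type*} (μ : PMF Γ) : Summable fun s => (μ s).toReal :=
  ENNReal.summable_toReal (by simp [μ.tsum_coe])

theorem hasSum_toReal_pmf {Γ : Type*} (μ : PMF Γ) : HasSum (fun s => (μ s).toReal) 1 := by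
  have h := (summable_toReal_pmf μ).hasSum
  rwa [← ENNReal.tsum_toReal_eq fun s => μ.apply_ne_top s, μ.tsum_coe, ENNReal.toReal_one] at h

/-- The averaging operator `P x = ∑ₛ μ(s) uₛ⋆ x uₛ` of a probability measure `μ` on `Γ` and a
unitary representation `u` of `Γ` in a C⋆-algebra. -/
def conjAverage (μ : PMF Γ) (u : Γ →* unitary E) : E →L[ℂ] E :=
  ∑' s, ((μ s).toReal : ℂ) • ContinuousLinearMap.mulLeftRight ℂ E (star (u s : E)) (u s : E)

theorem norm_mulLeftRight_unitary_le (v : unitary E) :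
    ‖ContinuousLinearMap.mulLeftRight ℂ E (star (v : E)) (v : E)‖ ≤ 1 := by
  have hv : ‖(v : E)‖ ≤ 1 := by
    nontriviality E
    exact (CStarRing.norm_coe_unitary v).le
  refine (ContinuousLinearMap.opNorm_mulLeftRight_apply_apply_le ℂ E _ _).trans ?_
  rw [norm_star]
  exact mul_le_one₀ hv (norm_nonneg _) hv

theorem norm_conjAverage_term_le (μ : PMF Γ) (u : Γ →* unitary E) (s : Γ) :
    ‖((μ s).toReal : ℂ) • ContinuousLinearMap.mulLeftRight ℂ E (star (u s : E)) (u s : E)‖ ≤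
      (μ s).toReal := by
  rw [norm_smul, Complex.norm_real, Real.norm_of_nonneg ENNReal.toReal_nonneg]
  exact mul_le_of_le_one_right ENNReal.toReal_nonneg (norm_mulLeftRight_unitary_le (u s))

theorem hasSum_conjAverage (μ : PMF Γ) (u : Γ →* unitary E) (x : E) :
    HasSum (fun s => ((μ s).toReal : ℂ) • (star (u s : E) * x * (u s : E)))
      (conjAverage μ u x) := by
  have h := (Summable.of_norm_bounded (summable_toReal_pmf μ)
    (norm_conjAverage_term_le μ u)).hasSum
  exact h.mapL (ContinuousLinearMap.apply ℂ E x)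

theorem norm_conjAverage_le (μ : PMF Γ) (u : Γ →* unitary E) : ‖conjAverage μ u‖ ≤ 1 :=
  tsum_of_norm_bounded (hasSum_toReal_pmf μ) (norm_conjAverage_term_le μ u)

theorem conjAverage_one (μ : PMF Γ) (u : Γ →* unitary E) : conjAverage μ u 1 = 1 := by
  refine (hasSum_conjAverage μ u 1).unique ?_
  have h := ((Complex.hasSum_ofReal).2 (hasSum_toReal_pmf μ)).smul_const (1 : E)
  simpa using h

/-- A continuous functional invariant under averaging satisfies the defining series of
stationarity. -/
theorem hasSum_of_conjAverage_invariant {μ : PMF Γ} {u : Γ →* unitary E} {ψ : E →L[ℂ] ℂ}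
    (hψ : ∀ x, ψ (conjAverage μ u x) = ψ x) (x : E) :
    HasSum (fun s => ((μ s).toReal : ℂ) * ψ (star (u s : E) * x * (u s : E))) (ψ x) := by
  have h := (hasSum_conjAverage μ u x).mapL ψ
  rw [hψ] at h
  simpa using h

end Averaging

/-! ### Norm averaging in the reduced group C⋆-algebra -/

section Powers

variable {K : Type*} [NormedAddCommGroup K] [InnerProductSpace ℂ K]

/-- The functional `X ↦ ⟨ξ, X ξ⟩` on bounded operators. -/
def vectorFunctional (ξ : K) : (K →L[ℂ] K) →L[ℂ] ℂ :=
  (innerSL ℂ ξ).comp (ContinuousLinearMap.apply ℂ K ξ)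

theorem vectorFunctional_apply (ξ : K) (X : K →L[ℂ] K) :
    vectorFunctional ξ X = inner ℂ ξ (X ξ) := rfl

theorem norm_vectorFunctional_le {ξ : K} (hξ : ‖ξ‖ = 1) : ‖vectorFunctional ξ‖ ≤ 1 := by
  refine ContinuousLinearMap.opNorm_le_bound _ zero_le_one fun X => ?_
  rw [vectorFunctional_apply]
  refine (norm_inner_le_norm _ _).trans ?_
  simpa [hξ] using X.le_opNorm ξ

/-- The numerical radius controls the norm, by polarization. -/
theorem opNorm_le_two_mul_of_vectorFunctional_le {X : K →L[ℂ] K} {c : ℝ} (hc : 0 ≤ c)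
    (h : ∀ ξ : K, ‖ξ‖ = 1 → ‖vectorFunctional ξ X‖ ≤ c) : ‖X‖ ≤ 2 * c := by
  have hq : ∀ ζ : K, ‖inner ℂ (X ζ) ζ‖ ≤ c * (‖ζ‖ * ‖ζ‖) := by
    intro ζ
    rw [norm_inner_symm]
    by_cases hζ : ‖ζ‖ = 0
    · simp [norm_eq_zero.1 hζ]
    have h1 := h (((‖ζ‖⁻¹ : ℝ) : ℂ) • ζ) (by
      rw [norm_smul, Complex.norm_real, norm_inv, norm_norm, inv_mul_cancel₀ hζ])
    rw [vectorFunctional_apply, map_smul, inner_smul_left, inner_smul_right, norm_mul, norm_mul,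
      RCLike.norm_conj, Complex.norm_real, norm_inv, norm_norm] at h1
    calc ‖inner ℂ ζ (X ζ)‖ = ‖ζ‖⁻¹ * (‖ζ‖⁻¹ * ‖inner ℂ ζ (X ζ)‖) * (‖ζ‖ * ‖ζ‖) := by field_simp
      _ ≤ _ := by gcongr
  refine ContinuousLinearMap.opNorm_le_of_re_inner_le (𝕜 := ℂ) (by positivity)
    fun x y hx hy => ?_
  refine (RCLike.re_le_norm _).trans ?_
  have hpol := inner_map_polarization' (X : K →ₗ[ℂ] K) x y
  simp only [ContinuousLinearMap.coe_coe] at hpol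
  rw [hpol, norm_div]
  have hI : ‖Complex.I • y‖ = 1 := by simp [norm_smul, hy]
  have hp1 := parallelogram_law_with_norm ℂ x y
  have hp2 := parallelogram_law_with_norm ℂ x (Complex.I • y)
  rw [hx, hy] at hp1
  rw [hx, hI] at hp2
  have hb : ‖inner ℂ (X (x + y)) (x + y) - inner ℂ (X (x - y)) (x - y) -
      Complex.I * inner ℂ (X (x + Complex.I • y)) (x + Complex.I • y) +
      Complex.I * inner ℂ (X (x - Complex.I • y)) (x - Complex.I • y)‖ ≤ c * 8 := by
    refine (norm_add_le _ _).trans ?_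
    have e1 := norm_sub_le (inner ℂ (X (x + y)) (x + y) - inner ℂ (X (x - y)) (x - y))
      (Complex.I * inner ℂ (X (x + Complex.I • y)) (x + Complex.I • y))
    have e2 := norm_sub_le (inner ℂ (X (x + y)) (x + y)) (inner ℂ (X (x - y)) (x - y))
    have q1 := hq (x + y)
    have q2 := hq (x - y)
    have q3 := hq (x + Complex.I • y)
    have q4 := hq (x - Complex.I • y)
    rw [norm_mul, Complex.norm_I, one_mul] at e1 ⊢
    -- by the parallelogram law the four squared norms add up to `4 + 4`
    have hs : c * (‖x + y‖ * ‖x + y‖) + c * (‖x - y‖ * ‖x - y‖) +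
        c * (‖x + Complex.I • y‖ * ‖x + Complex.I • y‖) +
        c * (‖x - Complex.I • y‖ * ‖x - Complex.I • y‖) = c * 8 := by
      linear_combination c * hp1 + c * hp2
    linarith
  rw [div_le_iff₀ (by norm_num), show ‖(4 : ℂ)‖ = 4 by norm_num]
  linarith

variable {Γ : Type*} [Group Γ]

theorem translation_apply {H : Type*} [NormedAddCommGroup H] [InnerProductSpace ℂ H]
    [CompleteSpace H] (s : Γ) (ξ : L2 Γ H) (t : Γ) :
    (translation Γ H s : L2 Γ H →L[ℂ] L2 Γ H) ξ t = ξ (s⁻¹ * t) := rfl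

theorem star_translation {H : Type*} [NormedAddCommGroup H] [InnerProductSpace ℂ H]
    [CompleteSpace H] (s : Γ) :
    star (translation Γ H s : L2 Γ H →L[ℂ] L2 Γ H) = translation Γ H s⁻¹ := by
  rw [map_inv]
  rfl

/-- In the reduced group C⋆-algebra the inner action of `s⁻¹` is the conjugation that `conjAverage`
averages over. -/
theorem coe_innerAction_inv_apply (s : Γ) (x : reducedCStar Γ) :
    ((innerAction Γ s⁻¹ x : reducedCStar Γ) : L2 Γ ℂ →L[ℂ] L2 Γ ℂ) =
      star (translation Γ ℂ s : L2 Γ ℂ →L[ℂ] L2 Γ ℂ) * x * translation Γ ℂ s := by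
  have h : ((innerAction Γ s⁻¹ x : reducedCStar Γ) : L2 Γ ℂ →L[ℂ] L2 Γ ℂ) =
      (translation Γ ℂ s⁻¹ : L2 Γ ℂ →L[ℂ] L2 Γ ℂ) * x *
        star (translation Γ ℂ s⁻¹ : L2 Γ ℂ →L[ℂ] L2 Γ ℂ) := rfl
  rw [h, star_translation, star_translation, inv_inv]

theorem canonicalTrace_leftRegular {s : Γ} (hs : s ≠ 1) :
    canonicalTrace Γ (leftRegular Γ s : reducedCStar Γ) = 0 := by
  classical
  change inner ℂ (lp.single 2 (1 : Γ) (1 : ℂ) : L2 Γ ℂ)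
    ((translation Γ ℂ s : L2 Γ ℂ →L[ℂ] L2 Γ ℂ) (lp.single 2 (1 : Γ) (1 : ℂ))) = 0
  rw [lp.inner_single_left, translation_apply, lp.single_apply_ne]
  · simp
  · simpa using hs

/-- For a C⋆-simple measure the Cesàro means of the averages of `λ_s`, `s ≠ 1`, become arbitrarily
small in norm. If they did not, functionals given by unit vectors would detect it, and an invariant
limit of these would be a stationary state that does not vanish at `λ_s`, unlike the trace. -/
theorem exists_norm_cesaro_translation_lt {μ : PMF Γ} (hμ : IsCStarSimpleMeasure μ) {s : Γ}
    (hs : s ≠ 1) {ε : ℝ} (hε : 0 < ε) :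
    ∃ n, ‖cesaro (conjAverage μ (translation Γ ℂ)) n
      (translation Γ ℂ s : L2 Γ ℂ →L[ℂ] L2 Γ ℂ)‖ < ε := by
  by_contra! hcon
  set P := conjAverage μ (translation Γ ℂ) with hP
  have hξ : ∀ n, ∃ ξ : L2 Γ ℂ, ‖ξ‖ = 1 ∧
      ε / 4 ≤ ‖vectorFunctional ξ (cesaro P n (translation Γ ℂ s : L2 Γ ℂ →L[ℂ] L2 Γ ℂ))‖ := by
    intro n
    by_contra! h
    have h1 := opNorm_le_two_mul_of_vectorFunctional_le (by positivity : 0 ≤ ε / 4)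
      fun ξ hξ => (h ξ hξ).le
    linarith [hcon n]
  choose ξ hξ1 hξ2 using hξ
  -- a limit of these functionals is a stationary state of modulus at least `ε / 4` at `λ_s`
  obtain ⟨ψ, hψ1, hψP, hψC⟩ := exists_invariant_limit (norm_conjAverage_le μ (translation Γ ℂ))
    (fun n => vectorFunctional (ξ n)) fun n => norm_vectorFunctional_le (hξ1 n)
  have hone : ψ 1 = 1 := by
    refine hψC 1 {1} isClosed_singleton fun n => ?_
    rw [cesaro_apply_of_fixed (conjAverage_one μ _), Set.mem_singleton_iff,
      vectorFunctional_apply, one_apply_eq_self, inner_self_eq_norm_sq_to_K, hξ1]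
    simp
  have hlow : ε / 4 ≤ ‖ψ (translation Γ ℂ s : L2 Γ ℂ →L[ℂ] L2 Γ ℂ)‖ :=
    hψC _ {z | ε / 4 ≤ ‖z‖} (isClosed_le continuous_const continuous_norm) hξ2
  have htrace := (hμ ((ψ : (L2 Γ ℂ →L[ℂ] L2 Γ ℂ) →ₗ[ℂ] ℂ).comp
    (reducedCStar Γ).subtype.toLinearMap)).1 ⟨⟨fun a => ?_, hone⟩, fun a => ?_⟩
  · have h0 := DFunLike.congr_fun htrace (leftRegular Γ s : reducedCStar Γ)
    rw [canonicalTrace_leftRegular hs] at h0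
    have h1 : ψ (translation Γ ℂ s : L2 Γ ℂ →L[ℂ] L2 Γ ℂ) = 0 := h0
    rw [h1, norm_zero] at hlow
    linarith
  · exact apply_star_mul_self_nonneg hψ1 hone (a : L2 Γ ℂ →L[ℂ] L2 Γ ℂ)
  · refine (hasSum_of_conjAverage_invariant hψP (a : L2 Γ ℂ →L[ℂ] L2 Γ ℂ)).congr_fun fun t => ?_
    rw [← coe_innerAction_inv_apply]
    rfl

end Powers

/-! ### Domination by operators with nonnegative matrix coefficients -/

section Domination

variable {Γ : Type*} {H : Type*} [NormedAddCommGroup H]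

/-- The pointwise norm `t ↦ ‖ξ t‖` of a vector `ξ`, as a vector of `ℓ²(Γ)`. -/
def absL2 (ξ : L2 Γ H) : L2 Γ ℂ :=
  ⟨fun t => (‖ξ t‖ : ℂ), by
    apply memℓp_gen
    simpa using (lp.memℓp ξ).summable (by norm_num)⟩

theorem absL2_apply (ξ : L2 Γ H) (t : Γ) : absL2 ξ t = (‖ξ t‖ : ℂ) := rfl

theorem norm_absL2_le (ξ : L2 Γ H) : ‖absL2 ξ‖ ≤ ‖ξ‖ :=
  lp.norm_mono two_ne_zero fun t => by simp [absL2_apply]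

variable [InnerProductSpace ℂ H]

/-- `X` on `ℓ²(Γ, H)` is dominated by `Y` on `ℓ²(Γ)` when `‖(X ξ)(t)‖ ≤ Re (Y |ξ|)(t)` for all `ξ`
and `t`, where `|ξ|` is the pointwise norm of `ξ`. -/
def IsDominatedBy (X : L2 Γ H →L[ℂ] L2 Γ H) (Y : L2 Γ ℂ →L[ℂ] L2 Γ ℂ) : Prop :=
  ∀ ξ t, ‖X ξ t‖ ≤ (Y (absL2 ξ) t).re

namespace IsDominatedBy

variable {X : L2 Γ H →L[ℂ] L2 Γ H} {Y : L2 Γ ℂ →L[ℂ] L2 Γ ℂ}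

theorem norm_le (h : IsDominatedBy X Y) : ‖X‖ ≤ ‖Y‖ := by
  refine X.opNorm_le_bound (norm_nonneg _) fun ξ => ?_
  calc ‖X ξ‖ ≤ ‖Y (absL2 ξ)‖ :=
        lp.norm_mono two_ne_zero fun t => (h ξ t).trans (Complex.re_le_norm _)
    _ ≤ ‖Y‖ * ‖absL2 ξ‖ := Y.le_opNorm _
    _ ≤ ‖Y‖ * ‖ξ‖ := by gcongr; exact norm_absL2_le ξ

theorem smul {r : ℝ} (hr : 0 ≤ r) (h : IsDominatedBy X Y) :
    IsDominatedBy ((r : ℂ) • X) ((r : ℂ) • Y) := by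
  intro ξ t
  have h1 : ((r : ℂ) • X) ξ t = (r : ℂ) • X ξ t := rfl
  have h2 : ((r : ℂ) • Y) (absL2 ξ) t = (r : ℂ) * Y (absL2 ξ) t := rfl
  rw [h1, h2, norm_smul, Complex.re_ofReal_mul, Complex.norm_real, Real.norm_of_nonneg hr]
  exact mul_le_mul_of_nonneg_left (h ξ t) hr

theorem hasSum {ι : Type*} {F : ι → L2 Γ H →L[ℂ] L2 Γ H} {G : ι → L2 Γ ℂ →L[ℂ] L2 Γ ℂ}
    (hF : HasSum F X) (hG : HasSum G Y) (h : ∀ i, IsDominatedBy (F i) (G i)) :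
    IsDominatedBy X Y := by
  intro ξ t
  have h1 : HasSum (fun i => F i ξ t) (X ξ t) :=
    (hF.mapL (ContinuousLinearMap.apply ℂ _ ξ)).mapL (lp.evalCLM ℂ (fun _ : Γ => H) 2 t)
  have h2 : HasSum (fun i => G i (absL2 ξ) t) (Y (absL2 ξ) t) :=
    (hG.mapL (ContinuousLinearMap.apply ℂ _ (absL2 ξ))).mapL
      (lp.evalCLM ℂ (fun _ : Γ => ℂ) 2 t)
  exact h1.norm_le_of_bounded (Complex.hasSum_re h2) fun i => h i ξ t

variable [Group Γ] [CompleteSpace H]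

theorem conj (h : IsDominatedBy X Y) (s : Γ) :
    IsDominatedBy (star (translation Γ H s : L2 Γ H →L[ℂ] L2 Γ H) * X *
        (translation Γ H s : L2 Γ H →L[ℂ] L2 Γ H))
      (star (translation Γ ℂ s : L2 Γ ℂ →L[ℂ] L2 Γ ℂ) * Y *
        (translation Γ ℂ s : L2 Γ ℂ →L[ℂ] L2 Γ ℂ)) := by
  intro ξ t
  rw [star_translation, star_translation]
  exact h ((translation Γ H s : L2 Γ H →L[ℂ] L2 Γ H) ξ) (s⁻¹⁻¹ * t)

theorem conjAverage (h : IsDominatedBy X Y) (μ : PMF Γ) :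
    IsDominatedBy (conjAverage μ (translation Γ H) X) (conjAverage μ (translation Γ ℂ) Y) :=
  hasSum (hasSum_conjAverage μ _ X) (hasSum_conjAverage μ _ Y) fun s =>
    (h.conj s).smul ENNReal.toReal_nonneg

theorem cesaro (h : IsDominatedBy X Y) (μ : PMF Γ) (n : ℕ) :
    IsDominatedBy (cesaro (CrossedProd.conjAverage μ (translation Γ H)) n X)
      (CrossedProd.cesaro (CrossedProd.conjAverage μ (translation Γ ℂ)) n Y) := by
  have hk : ∀ k, IsDominatedBy ((CrossedProd.conjAverage μ (translation Γ H) ^ k) X)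
      ((CrossedProd.conjAverage μ (translation Γ ℂ) ^ k) Y) := by
    intro k
    induction k with
    | zero => simpa using h
    | succ k ih =>
      rw [pow_succ', pow_succ']
      exact ih.conjAverage μ
  rw [cesaro_apply, cesaro_apply]
  have hsum := hasSum (hasSum_fintype _) (hasSum_fintype _)
    fun k : Fin (n + 1) => hk k
  rw [Fin.sum_univ_eq_sum_range fun k => (CrossedProd.conjAverage μ (translation Γ H) ^ k) X,
    Fin.sum_univ_eq_sum_range fun k => (CrossedProd.conjAverage μ (translation Γ ℂ) ^ k) Y] at hsum
  have := hsum.smul (r := ((n : ℝ) + 1)⁻¹) (by positivity)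
  simpa only [Complex.ofReal_inv, Complex.ofReal_add, Complex.ofReal_natCast,
    Complex.ofReal_one] using this

end IsDominatedBy

end Domination

/-! ### Stationary functionals on the crossed product -/

section CrossedProductFunctionals

variable {Γ : Type*} [Group Γ] {A : Type*} [CStarAlgebra A]
  {H : Type*} [NormedAddCommGroup H] [InnerProductSpace ℂ H] [CompleteSpace H]
  (α : Γ →* (A ≃⋆ₐ[ℂ] A)) (π : A →⋆ₐ[ℂ] (H →L[ℂ] H))

theorem sigma_apply (a : A) (ξ : L2 Γ H) (t : Γ) : sigma α π a ξ t = π (α t⁻¹ a) (ξ t) := rfl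

/-- The map `a ↦ σ(a)` as a `⋆`-homomorphism. -/
def sigmaHom : A →⋆ₐ[ℂ] (L2 Γ H →L[ℂ] L2 Γ H) where
  toFun := sigma α π
  map_one' := by ext ξ t; simp [sigma_apply]
  map_mul' a b := by ext ξ t; simp [sigma_apply]
  map_zero' := by ext ξ t; simp [sigma_apply]
  map_add' a b := by ext ξ t; simp [sigma_apply]
  commutes' c := by
    ext ξ t
    simp [sigma_apply, Algebra.algebraMap_eq_smul_one]
  map_star' a := by
    rw [ContinuousLinearMap.star_eq_adjoint, ContinuousLinearMap.eq_adjoint_iff]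
    intro ξ η
    rw [lp.inner_eq_tsum, lp.inner_eq_tsum]
    congr 1
    ext t
    rw [sigma_apply, sigma_apply, map_star, map_star, ContinuousLinearMap.star_eq_adjoint,
      ContinuousLinearMap.adjoint_inner_left]

theorem sigmaHom_apply (a : A) (ξ : L2 Γ H) (t : Γ) :
    sigmaHom α π a ξ t = π (α t⁻¹ a) (ξ t) := rfl

theorem translation_mul_sigmaHom (s : Γ) (a : A) :
    (translation Γ H s : L2 Γ H →L[ℂ] L2 Γ H) * sigmaHom α π a =
      sigmaHom α π (α s a) * (translation Γ H s : L2 Γ H →L[ℂ] L2 Γ H) := by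
  ext ξ t
  change π (α (s⁻¹ * t)⁻¹ a) (ξ (s⁻¹ * t)) = π (α t⁻¹ (α s a)) (ξ (s⁻¹ * t))
  simp [map_mul]

/-- Conjugation by `λ̃_s` implements the action of `Γ` on `A`, so that stationarity on `ℓ²(Γ, H)`
restricts to stationarity on `A`. -/
theorem star_translation_mul_sigmaHom_mul (s : Γ) (a : A) :
    star (translation Γ H s : L2 Γ H →L[ℂ] L2 Γ H) * sigmaHom α π a *
      (translation Γ H s : L2 Γ H →L[ℂ] L2 Γ H) = sigmaHom α π (α s⁻¹ a) := by
  rw [star_translation, translation_mul_sigmaHom, mul_assoc, ← Submonoid.coe_mul, ← map_mul]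
  simp

/-- The algebraic crossed product, spanned by the products `σ(a) λ̃_s`. -/
def algebraicCrossedProduct : Submodule ℂ (L2 Γ H →L[ℂ] L2 Γ H) :=
  Submodule.span ℂ (Set.range fun p : A × Γ =>
    sigmaHom α π p.1 * (translation Γ H p.2 : L2 Γ H →L[ℂ] L2 Γ H))

variable {α π}

theorem sigmaHom_mul_translation_mem (a : A) (s : Γ) :
    sigmaHom α π a * (translation Γ H s : L2 Γ H →L[ℂ] L2 Γ H) ∈ algebraicCrossedProduct α π :=
  Submodule.subset_span ⟨(a, s), rfl⟩

theorem mul_mem_algebraicCrossedProduct {X Y : L2 Γ H →L[ℂ] L2 Γ H}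
    (hX : X ∈ algebraicCrossedProduct α π) (hY : Y ∈ algebraicCrossedProduct α π) :
    X * Y ∈ algebraicCrossedProduct α π := by
  have h := Submodule.mul_mem_mul hX hY
  rw [algebraicCrossedProduct, Submodule.span_mul_span] at h
  refine Submodule.span_le.2 ?_ h
  rintro _ ⟨_, ⟨⟨a, s⟩, rfl⟩, _, ⟨⟨b, t⟩, rfl⟩, rfl⟩
  have h1 : sigmaHom α π a * (translation Γ H s : L2 Γ H →L[ℂ] L2 Γ H) *
      (sigmaHom α π b * (translation Γ H t : L2 Γ H →L[ℂ] L2 Γ H)) =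
        sigmaHom α π (a * α s b) * (translation Γ H (s * t) : L2 Γ H →L[ℂ] L2 Γ H) := by
    rw [map_mul, map_mul, Submonoid.coe_mul, mul_assoc, ← mul_assoc _ (sigmaHom α π b),
      translation_mul_sigmaHom]
    simp only [mul_assoc]
  simp only [h1]
  exact sigmaHom_mul_translation_mem _ _

theorem star_mem_algebraicCrossedProduct {X : L2 Γ H →L[ℂ] L2 Γ H}
    (hX : X ∈ algebraicCrossedProduct α π) : star X ∈ algebraicCrossedProduct α π := by
  induction hX using Submodule.span_induction with
  | mem x hx =>
    obtain ⟨⟨a, s⟩, rfl⟩ := hx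
    simp only [star_mul, star_translation, ← map_star, translation_mul_sigmaHom]
    exact sigmaHom_mul_translation_mem _ _
  | zero => simp
  | add x y _ _ hx hy => simpa using add_mem hx hy
  | smul c x _ hx => simpa using Submodule.smul_mem _ _ hx

theorem reducedCrossedProduct_subset_closure :
    (reducedCrossedProduct α π : Set (L2 Γ H →L[ℂ] L2 Γ H)) ⊆
      closure (algebraicCrossedProduct α π : Set (L2 Γ H →L[ℂ] L2 Γ H)) := by
  refine closure_mono fun X hX => ?_
  induction hX using StarAlgebra.adjoin_induction with
  | mem x hx =>
    rcases hx with ⟨s, rfl⟩ | ⟨a, rfl⟩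
    · simpa using sigmaHom_mul_translation_mem (α := α) (π := π) 1 s
    · have h := sigmaHom_mul_translation_mem (α := α) (π := π) a 1
      rwa [map_one, Submonoid.coe_one, mul_one] at h
  | algebraMap c =>
    have h := sigmaHom_mul_translation_mem (α := α) (π := π) (algebraMap ℂ A c) 1
    rwa [AlgHomClass.commutes, map_one, Submonoid.coe_one, mul_one] at h
  | add x y _ _ hx hy => exact add_mem hx hy
  | mul x y _ _ hx hy => exact mul_mem_algebraicCrossedProduct hx hy
  | star x _ hx => exact star_mem_algebraicCrossedProduct hx

theorem isDominatedBy_sigmaHom_mul_translation (a : A) (s : Γ) :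
    IsDominatedBy (sigmaHom α π a * (translation Γ H s : L2 Γ H →L[ℂ] L2 Γ H))
      ((‖a‖ : ℂ) • (translation Γ ℂ s : L2 Γ ℂ →L[ℂ] L2 Γ ℂ)) := by
  intro ξ t
  have h1 : (((‖a‖ : ℂ) • (translation Γ ℂ s : L2 Γ ℂ →L[ℂ] L2 Γ ℂ)) (absL2 ξ) t).re =
      ‖a‖ * ‖ξ (s⁻¹ * t)‖ := by
    change ((‖a‖ : ℂ) * (‖ξ (s⁻¹ * t)‖ : ℂ)).re = _
    rw [← Complex.ofReal_mul, Complex.ofReal_re]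
  rw [h1]
  change ‖π (α t⁻¹ a) (ξ (s⁻¹ * t))‖ ≤ _
  refine ((π (α t⁻¹ a)).le_opNorm _).trans ?_
  gcongr
  exact (NonUnitalStarAlgHom.norm_apply_le π _).trans (StarAlgEquiv.norm_map (α t⁻¹) a).le

/-- A contractive functional that is stationary for a C⋆-simple measure vanishes at `σ(a) λ̃_s` for
`s ≠ 1`: it does not distinguish this operator from its Cesàro means, which are dominated by `‖a‖`
times those of `λ_s`. -/
theorem apply_sigmaHom_mul_translation_eq_zero {μ : PMF Γ} (hμ : IsCStarSimpleMeasure μ)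
    {ψ : (L2 Γ H →L[ℂ] L2 Γ H) →L[ℂ] ℂ} (hψ : ‖ψ‖ ≤ 1)
    (hinv : ∀ X, ψ (conjAverage μ (translation Γ H) X) = ψ X) (a : A) {s : Γ} (hs : s ≠ 1) :
    ψ (sigmaHom α π a * (translation Γ H s : L2 Γ H →L[ℂ] L2 Γ H)) = 0 := by
  rw [← norm_le_zero_iff]
  refine le_of_forall_pos_le_add fun ε hε => ?_
  obtain ⟨n, hn⟩ := exists_norm_cesaro_translation_lt hμ hs
    (div_pos hε (by positivity : 0 < ‖a‖ + 1))
  rw [← apply_cesaro_apply_of_invariant hinv n, zero_add]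
  refine (ψ.le_of_opNorm_le hψ _).trans ?_
  rw [one_mul]
  refine ((isDominatedBy_sigmaHom_mul_translation a s).cesaro μ n).norm_le.trans ?_
  rw [map_smul, norm_smul, Complex.norm_real, norm_norm]
  calc _ ≤ (‖a‖ + 1) * (ε / (‖a‖ + 1)) :=
        mul_le_mul (by linarith) hn.le (norm_nonneg _) (by positivity)
    _ = ε := by field_simp

open Classical in
/-- The diagonal entry at `(t, t)` of an operator on `ℓ²(Γ, H)`, written as a matrix over `Γ` with
entries in `B(H)`. -/
def diagEntry (Γ H : Type*) [NormedAddCommGroup H] [InnerProductSpace ℂ H] (t : Γ) :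
    (L2 Γ H →L[ℂ] L2 Γ H) →L[ℂ] (H →L[ℂ] H) :=
  (ContinuousLinearMap.compL ℂ H (L2 Γ H) H (lp.evalCLM ℂ (fun _ : Γ => H) 2 t)).comp
    ((ContinuousLinearMap.compL ℂ H (L2 Γ H) (L2 Γ H)).flip
      (lp.singleContinuousLinearMap ℂ (fun _ : Γ => H) 2 t))

open Classical in
theorem diagEntry_apply {Γ H : Type*} [NormedAddCommGroup H] [InnerProductSpace ℂ H] (t : Γ)
    (X : L2 Γ H →L[ℂ] L2 Γ H) (v : H) :
    diagEntry Γ H t X v = X (lp.single 2 t v) t := rfl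

theorem norm_diagEntry_le {Γ H : Type*} [NormedAddCommGroup H] [InnerProductSpace ℂ H] (t : Γ)
    (X : L2 Γ H →L[ℂ] L2 Γ H) : ‖diagEntry Γ H t X‖ ≤ ‖X‖ := by
  classical
  refine ContinuousLinearMap.opNorm_le_bound _ (norm_nonneg X) fun v => ?_
  rw [diagEntry_apply]
  refine (lp.norm_apply_le_norm two_ne_zero _ _).trans ((X.le_opNorm _).trans ?_)
  rw [lp.norm_single (by norm_num)]

/-- `a` is the value at `X` of the canonical conditional expectation onto `A`: for every `t` the
diagonal entry of `X` at `(t, t)` is `π(t⁻¹ a)`. -/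
def HasDiagonal (α : Γ →* (A ≃⋆ₐ[ℂ] A)) (π : A →⋆ₐ[ℂ] (H →L[ℂ] H))
    (X : L2 Γ H →L[ℂ] L2 Γ H) (a : A) : Prop :=
  ∀ t : Γ, diagEntry Γ H t X = π (α t⁻¹ a)

theorem HasDiagonal.norm_le (hπ : Function.Injective π) {X : L2 Γ H →L[ℂ] L2 Γ H} {a : A}
    (h : HasDiagonal α π X a) : ‖a‖ ≤ ‖X‖ := by
  have h1 := h 1
  rw [inv_one, map_one, StarAlgEquiv.one_apply] at h1
  rw [← NonUnitalStarAlgHom.norm_map π hπ, ← h1]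
  exact norm_diagEntry_le 1 X

theorem HasDiagonal.add {X Y : L2 Γ H →L[ℂ] L2 Γ H} {a b : A} (hX : HasDiagonal α π X a)
    (hY : HasDiagonal α π Y b) : HasDiagonal α π (X + Y) (a + b) := fun t => by
  rw [map_add, hX t, hY t, map_add, map_add]

theorem HasDiagonal.sub {X Y : L2 Γ H →L[ℂ] L2 Γ H} {a b : A} (hX : HasDiagonal α π X a)
    (hY : HasDiagonal α π Y b) : HasDiagonal α π (X - Y) (a - b) := fun t => by
  rw [map_sub, hX t, hY t, map_sub, map_sub]

theorem HasDiagonal.smul {X : L2 Γ H →L[ℂ] L2 Γ H} {a : A} (c : ℂ) (hX : HasDiagonal α π X a) :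
    HasDiagonal α π (c • X) (c • a) := fun t => by
  rw [map_smul, hX t, map_smul, map_smul]

theorem HasDiagonal.of_tendsto {X : ℕ → L2 Γ H →L[ℂ] L2 Γ H} {a : ℕ → A}
    {X' : L2 Γ H →L[ℂ] L2 Γ H} {a' : A} (h : ∀ n, HasDiagonal α π (X n) (a n))
    (hX : Tendsto X atTop (𝓝 X')) (ha : Tendsto a atTop (𝓝 a')) : HasDiagonal α π X' a' := by
  intro t
  have hπα : Continuous fun b : A => π (α t⁻¹ b) :=
    (map_continuous π).comp (StarAlgEquiv.isometry (α t⁻¹)).continuous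
  have h1 := ((diagEntry Γ H t).continuous.tendsto X').comp hX
  have h2 := (hπα.tendsto a').comp ha
  refine tendsto_nhds_unique h1 (h2.congr fun n => ?_)
  exact (h n t).symm

theorem hasDiagonal_sigmaHom (a : A) : HasDiagonal α π (sigmaHom α π a) a := by
  classical
  intro t
  ext v
  rw [diagEntry_apply, sigmaHom_apply, lp.single_apply_self]

theorem hasDiagonal_sigmaHom_mul_translation (a : A) {s : Γ} (hs : s ≠ 1) :
    HasDiagonal α π (sigmaHom α π a * (translation Γ H s : L2 Γ H →L[ℂ] L2 Γ H)) 0 := by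
  classical
  intro t
  ext v
  rw [diagEntry_apply]
  change π (α t⁻¹ a) ((lp.single 2 t v : L2 Γ H) (s⁻¹ * t)) = _
  rw [lp.single_apply_ne]
  · simp
  · simpa using hs

/-- A stationary contractive functional factors through the canonical conditional expectation of
the reduced crossed product onto `A`. -/
theorem exists_hasDiagonal_and_apply_eq (hπ : Function.Injective π) {μ : PMF Γ}
    (hμ : IsCStarSimpleMeasure μ) {ψ : (L2 Γ H →L[ℂ] L2 Γ H) →L[ℂ] ℂ} (hψ : ‖ψ‖ ≤ 1)
    (hinv : ∀ X, ψ (conjAverage μ (translation Γ H) X) = ψ X) {X : L2 Γ H →L[ℂ] L2 Γ H}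
    (hX : X ∈ reducedCrossedProduct α π) :
    ∃ a, HasDiagonal α π X a ∧ ψ X = ψ (sigmaHom α π a) := by
  have halg : ∀ Y ∈ algebraicCrossedProduct α π,
      ∃ a, HasDiagonal α π Y a ∧ ψ Y = ψ (sigmaHom α π a) := by
    intro Y hY
    induction hY using Submodule.span_induction with
    | mem x hx =>
      obtain ⟨⟨a, s⟩, rfl⟩ := hx
      by_cases hs : s = 1
      · subst hs
        refine ⟨a, ?_, ?_⟩
        · simpa using hasDiagonal_sigmaHom (α := α) (π := π) a
        · simp
      · refine ⟨0, hasDiagonal_sigmaHom_mul_translation a hs, ?_⟩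
        rw [apply_sigmaHom_mul_translation_eq_zero hμ hψ hinv a hs]
        simp
    | zero => exact ⟨0, fun t => by simp, by simp⟩
    | add x y _ _ hx hy =>
      obtain ⟨a, ha, ha'⟩ := hx
      obtain ⟨b, hb, hb'⟩ := hy
      exact ⟨a + b, ha.add hb, by simp [ha', hb']⟩
    | smul c x _ hx =>
      obtain ⟨a, ha, ha'⟩ := hx
      exact ⟨c • a, ha.smul c, by simp [ha']⟩
  obtain ⟨Y, hY, hYX⟩ := mem_closure_iff_seq_limit.1 (reducedCrossedProduct_subset_closure hX)
  choose a ha ha' using fun n => halg (Y n) (hY n)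
  -- the diagonal determines `a` isometrically, so the approximants converge in `A`
  have hcauchy : CauchySeq a := by
    rw [Metric.cauchySeq_iff]
    intro ε hε
    obtain ⟨N, hN⟩ := Metric.cauchySeq_iff.1 hYX.cauchySeq ε hε
    refine ⟨N, fun m hm n hn => lt_of_le_of_lt ?_ (hN m hm n hn)⟩
    rw [dist_eq_norm, dist_eq_norm]
    exact ((ha m).sub (ha n)).norm_le hπ
  obtain ⟨b, hb⟩ := cauchySeq_tendsto_of_complete hcauchy
  refine ⟨b, HasDiagonal.of_tendsto ha hYX hb, ?_⟩
  have h1 := (ψ.continuous.tendsto X).comp hYX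
  have hσ : Continuous (sigmaHom α π : A →⋆ₐ[ℂ] (L2 Γ H →L[ℂ] L2 Γ H)) :=
    map_continuous _
  have h2 := ((ψ.continuous.comp hσ).tendsto b).comp hb
  exact tendsto_nhds_unique h1 (h2.congr fun n => (ha' n).symm)

/-- Contractive stationary functionals on `B(ℓ²(Γ, H))` that restrict to a faithful functional on
`A` are faithful on the reduced crossed product. -/
theorem eq_zero_of_apply_star_mul_self_eq_zero (hπ : Function.Injective π) {μ : PMF Γ}
    (hμ : IsCStarSimpleMeasure μ) {ψ : (L2 Γ H →L[ℂ] L2 Γ H) →L[ℂ] ℂ} (hψ : ‖ψ‖ ≤ 1)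
    (hinv : ∀ X, ψ (conjAverage μ (translation Γ H) X) = ψ X)
    (hfaith : ∀ a : A, ψ (sigmaHom α π (star a * a)) = 0 → a = 0) {X : L2 Γ H →L[ℂ] L2 Γ H}
    (hX : X ∈ reducedCrossedProduct α π) (h0 : ψ (star X * X) = 0) : X = 0 := by
  classical
  obtain ⟨a, ha, hψa⟩ := exists_hasDiagonal_and_apply_eq hπ hμ hψ hinv
    (mul_mem (star_mem hX) hX)
  have hdiag : ∀ (t : Γ) (v : H), inner ℂ v (π (α t⁻¹ a) v) =
      ((‖X (lp.single 2 t v)‖ : ℂ)) ^ 2 := by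
    intro t v
    have h1 : inner ℂ (lp.single 2 t v : L2 Γ H) ((star X * X) (lp.single 2 t v)) =
        inner ℂ v (diagEntry Γ H t (star X * X) v) := by
      rw [lp.inner_single_left, diagEntry_apply]
    rw [← ha t, ← h1, mul_apply_eq_comp, ContinuousLinearMap.star_eq_adjoint,
      ContinuousLinearMap.adjoint_inner_right, inner_self_eq_norm_sq_to_K]
    rfl
  -- `π a` is the diagonal entry of `X⋆ X` at the identity of `Γ`
  have hpos : 0 ≤ π a := by
    rw [ContinuousLinearMap.nonneg_iff_isPositive, ContinuousLinearMap.isPositive_iff_complex]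
    intro v
    have h1 := hdiag 1 v
    rw [inv_one, map_one, StarAlgEquiv.one_apply] at h1
    have h1' : inner ℂ v (π a v) = ((‖X (lp.single 2 (1 : Γ) v)‖ ^ 2 : ℝ) : ℂ) := by
      rw [Complex.ofReal_pow]
      exact h1
    have h2 : inner ℂ (π a v) v = ((‖X (lp.single 2 (1 : Γ) v)‖ ^ 2 : ℝ) : ℂ) := by
      rw [← inner_conj_symm, h1', Complex.conj_ofReal]
    rw [h2]
    refine ⟨rfl, ?_⟩
    exact (sq_nonneg _ : 0 ≤ ‖X (lp.single 2 (1 : Γ) v)‖ ^ 2)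
  obtain ⟨y, hy⟩ := CStarAlgebra.nonneg_iff_eq_star_mul_self.1 hpos
  obtain ⟨c, rfl⟩ := exists_eq_star_mul_self_of_map π hπ hy
  have hc : c = 0 := hfaith c (by rw [← hψa, h0])
  have hXsingle : ∀ (t : Γ) (v : H), X (lp.single 2 t v) = 0 := by
    intro t v
    have h1 := hdiag t v
    rw [hc] at h1
    simpa using h1.symm
  ext1 ξ
  have h1 := (lp.hasSum_single (by norm_num) ξ).mapL X
  simp only [hXsingle] at h1
  exact h1.unique hasSum_zero

end CrossedProductFunctionals

/-! ### Functionals annihilating an ideal -/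

section Ideals

variable {E : Type*} [CStarAlgebra E]

/-- A proper closed ideal of a closed unital subalgebra is annihilated by a contractive functional
on the ambient algebra that takes the value `1` at the unit: the unit has distance at least `1` from
the ideal, as an element at distance less than `1` from it is invertible. -/
theorem exists_functional_annihilating {B : StarSubalgebra ℂ E} (hB : IsClosed (B : Set E))
    {I : TwoSidedIdeal B} (hI : I ≠ ⊤) :
    ∃ f : E →L[ℂ] ℂ, ‖f‖ ≤ 1 ∧ f 1 = 1 ∧ ∀ b ∈ I, f (b : E) = 0 := by
  have hBc : CompleteSpace B := hB.completeSpace_coe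
  let V : Submodule ℂ E :=
    { carrier := {x | ∃ b ∈ I, (b : E) = x}
      add_mem' := by
        rintro _ _ ⟨b, hb, rfl⟩ ⟨c, hc, rfl⟩
        exact ⟨b + c, I.add_mem hb hc, rfl⟩
      zero_mem' := ⟨0, I.zero_mem, rfl⟩
      smul_mem' := by
        rintro c _ ⟨b, hb, rfl⟩
        refine ⟨c • b, ?_, rfl⟩
        have h := I.mul_mem_left (algebraMap ℂ B c) b hb
        rwa [← Algebra.smul_def] at h }
  -- otherwise `b = 1 - (1 - b)` would be invertible in the complete algebra `B`
  have hdist : ∀ b ∈ I, 1 ≤ ‖(1 : E) - b‖ := by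
    intro b hb
    by_contra! hlt
    have h1 : ‖(1 : B) - b‖ < 1 := hlt
    obtain ⟨v, hv⟩ := isUnit_one_sub_of_norm_lt_one h1
    rw [sub_sub_cancel] at hv
    apply hI
    rw [← TwoSidedIdeal.one_mem_iff]
    have h2 := I.mul_mem_left (↑v⁻¹ : B) b hb
    rwa [← hv, Units.inv_mul] at h2
  have hnorm : ‖(Submodule.Quotient.mk 1 : E ⧸ V)‖ = 1 := by
    refine le_antisymm ((Submodule.Quotient.norm_mk_le V (1 : E)).trans ?_) ?_
    · nontriviality E
      exact CStarRing.norm_one.le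
    · by_contra! hlt
      obtain ⟨m, hm, hm1⟩ := QuotientAddGroup.norm_lt_iff.1 hlt
      have hm' : (Submodule.Quotient.mk m : E ⧸ V) = Submodule.Quotient.mk 1 := hm
      obtain ⟨b, hb, hbm⟩ := (Submodule.Quotient.eq V).1 hm'.symm
      have h2 := hdist b hb
      rw [hbm, sub_sub_cancel] at h2
      linarith
  obtain ⟨g, hg, hg1⟩ := exists_dual_vector'' ℂ (Submodule.Quotient.mk 1 : E ⧸ V)
  rw [hnorm] at hg1
  have hbound : ∀ x, ‖((g : (E ⧸ V) →ₗ[ℂ] ℂ).comp V.mkQ) x‖ ≤ 1 * ‖x‖ := fun x => by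
    refine (g.le_of_opNorm_le hg _).trans ?_
    gcongr
    exact Submodule.Quotient.norm_mk_le V x
  refine ⟨LinearMap.mkContinuous _ 1 hbound, LinearMap.mkContinuous_norm_le _ zero_le_one _,
    by simpa using hg1, fun b hb => ?_⟩
  have h0 : V.mkQ (b : E) = 0 := (Submodule.Quotient.mk_eq_zero V).2 ⟨b, hb, rfl⟩
  rw [LinearMap.mkContinuous_apply, LinearMap.comp_apply, h0, map_zero]

/-- Averaging by conjugation with unitaries of `B` preserves closed ideals of `B`. -/
theorem conjAverage_mem_ideal {Γ : Type*} [Group Γ] (μ : PMF Γ) (u : Γ →* unitary E)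
    {B : StarSubalgebra ℂ E} (hB : IsClosed (B : Set E)) (hu : ∀ s, (u s : E) ∈ B)
    {I : TwoSidedIdeal B} (hI : IsClosed (I : Set B)) {x : E} (hx : ∃ b ∈ I, (b : E) = x) :
    ∃ b ∈ I, (b : E) = conjAverage μ u x := by
  obtain ⟨b, hb, rfl⟩ := hx
  have hcl : IsClosed ((Subtype.val : B → E) '' (I : Set B)) :=
    (hB.isClosedEmbedding_subtypeVal.isClosedMap) _ hI
  refine hcl.mem_of_tendsto (hasSum_conjAverage μ u (b : E)) (Eventually.of_forall fun F => ?_)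
  have h1 : ∀ s, ((μ s).toReal : ℂ) • (star (⟨u s, hu s⟩ : B) * b * (⟨u s, hu s⟩ : B)) ∈ I := by
    intro s
    have h := I.mul_mem_left (algebraMap ℂ B ((μ s).toReal : ℂ)) _
      (I.mul_mem_right _ (⟨u s, hu s⟩ : B) (I.mul_mem_left (star (⟨u s, hu s⟩ : B)) b hb))
    rwa [← Algebra.smul_def] at h
  refine ⟨_, sum_mem fun s (_ : s ∈ F) => h1 s, ?_⟩
  push_cast
  rfl

end Ideals

end CrossedProd

end

theorem mainTheorem2
    {Γ : Type*} [Group Γ] [Countable Γ] (hΓ : CrossedProd.IsCStarSimpleGroup Γ)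
    {A : Type*} [CStarAlgebra A] [Nontrivial A] (α : Γ →* (A ≃⋆ₐ[ℂ] A))
    {H : Type*} [NormedAddCommGroup H] [InnerProductSpace ℂ H] [CompleteSpace H]
    (π : A →⋆ₐ[ℂ] (H →L[ℂ] H)) (hπ : Function.Injective π)
    (hμ : ∃ μ : PMF Γ, CrossedProd.IsCStarSimpleMeasure μ ∧
      ∀ φ : A →ₗ[ℂ] ℂ, CrossedProd.IsState φ → CrossedProd.IsStationary μ α φ →
        CrossedProd.IsFaithful φ)
    (B : StarSubalgebra ℂ (CrossedProd.L2 Γ H →L[ℂ] CrossedProd.L2 Γ H))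
    (hBclosed : IsClosed (B : Set (CrossedProd.L2 Γ H →L[ℂ] CrossedProd.L2 Γ H)))
    (hΓB : CrossedProd.groupCStar Γ H ≤ B)
    (hBA : B ≤ CrossedProd.reducedCrossedProduct α π) :
    CrossedProd.IsSimpleCStar B := by
  classical
  open CrossedProd in
  obtain ⟨μ, hμ, hfaith⟩ := hμ
  have hu : ∀ s, (translation Γ H s : L2 Γ H →L[ℂ] L2 Γ H) ∈ B := fun s =>
    hΓB (StarSubalgebra.le_topologicalClosure _ (StarAlgebra.subset_adjoin ℂ _ ⟨s, rfl⟩))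
  refine ⟨?_, fun I hI => or_iff_not_imp_right.2 fun htop => ?_⟩
  · refine ⟨1, 0, fun h => one_ne_zero (α := A) (hπ ?_)⟩
    have h1 : (1 : L2 Γ H →L[ℂ] L2 Γ H) = 0 := congrArg Subtype.val h
    ext v
    have h2 := congrArg (fun X : L2 Γ H →L[ℂ] L2 Γ H => X (lp.single 2 (1 : Γ) v) 1) h1
    simpa using h2
  obtain ⟨f, hf, hf1, hfI⟩ := exists_functional_annihilating hBclosed htop
  obtain ⟨ψ, hψ, hinv, hψC⟩ := exists_invariant_limit
    (norm_conjAverage_le μ (translation Γ H)) (fun _ => f) fun _ => hf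
  have hone : ψ 1 = 1 := hψC 1 {1} isClosed_singleton fun n => by
    rw [cesaro_apply_of_fixed (conjAverage_one μ _), Set.mem_singleton_iff, hf1]
  have hψI : ∀ b ∈ I, ψ (b : L2 Γ H →L[ℂ] L2 Γ H) = 0 := by
    intro b hb
    refine hψC b {0} isClosed_singleton fun n => ?_
    let V : Submodule ℂ (L2 Γ H →L[ℂ] L2 Γ H) := (Submodule.restrictScalars ℂ
      (TwoSidedIdeal.asIdeal I)).map B.subtype.toLinearMap
    have hV : ∀ x ∈ V, conjAverage μ (translation Γ H) x ∈ V := fun x hx =>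
      conjAverage_mem_ideal μ _ hBclosed hu hI hx
    obtain ⟨c, hc, hc'⟩ := cesaro_apply_mem hV ⟨b, hb, rfl⟩ n
    exact hc' ▸ hfI c hc
  have hstat := hfaith ((ψ : (L2 Γ H →L[ℂ] L2 Γ H) →ₗ[ℂ] ℂ).comp
    (sigmaHom α π : A →⋆ₐ[ℂ] (L2 Γ H →L[ℂ] L2 Γ H)).toAlgHom.toLinearMap)
    ⟨fun a => ?_, ?_⟩ fun a => ?_
  · rw [eq_bot_iff]
    intro b hb
    rw [TwoSidedIdeal.mem_bot]
    refine Subtype.ext (eq_zero_of_apply_star_mul_self_eq_zero hπ hμ hψ hinv hstat (hBA b.2) ?_)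
    exact hψI (star b * b) (I.mul_mem_left _ _ hb)
  · change 0 ≤ ψ (sigmaHom α π (star a * a))
    rw [map_mul, map_star]
    exact apply_star_mul_self_nonneg hψ hone _
  · change ψ (sigmaHom α π 1) = 1
    rw [map_one, hone]
  · refine (hasSum_of_conjAverage_invariant hinv (sigmaHom α π a)).congr_fun fun s => ?_
    rw [star_translation_mul_sigmaHom_mul]
    rfl
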